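/- Let $n\ge 1$, $m\ge 1$ be integers and let $\mathcal E=\{e_1,\dots,e_n\}$ be the standard basis of $\mathbb Z^n$. Let $\mathcal A_m$ be the set of all lattices $\Lambda=\langle \mathbb Z^n,a_1,\dots,a_m\rangle_{\mathbb Z}$ with $a_1,\dots,a_m\in\mathbb Q^n$. The defect $d(\mathcal E,\Lambda)$ is the smallest integer $d$ such that some $n-d$ vectors of $\mathcal E$ together with some $d$ vectors of $\Lambda$ form a basis of $\Lambda$. The octahedron $O^n=\{x\in\mathbb R^n: |x_1|+\dots+|x_n|\le 1\}$ is called admissible with respect to $\Lambda$ if $O^n\cap\Lambda=\{0,\pm e_1,\dots,\pm e_n\}$. Let $$d_n^m=\max\{\,d(\mathcal E,\Lambda):\ \Lambda\in\mathcal A_m,\ O^n\text{ is admissible with respect to }\Lambda\,\}.$$ Theorem. There is an absolute constant $C>0$ such that for all integers $m\ge 1$ and $n\ge m+2$ (equivalently, for all $1\le m<n$ with $\ln\ln (n/m)^m>0$) $$d_n^m\le C\,\frac{n\ln(m+1)}{\ln\frac nm}\left(\ln\ln\left(\frac nm\right)^m\right)^2 .$$ -/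

import Mathlib

/-- The defect of the frame `e` (a family of `n` vectors of `ℝⁿ`) with respect to the lattice `Λ`:
the least `d` such that some `n - d` of the vectors `e i` (those with `i ∈ S`), together with some
`d` vectors of `Λ` (the `b i` with `i ∉ S`), form a `ℤ`-basis `b` of `Λ`. -/
noncomputable def frameDefect {n : ℕ} (e : Fin n → Fin n → ℝ) (Λ : Submodule ℤ (Fin n → ℝ)) : ℕ :=
  sInf {d : ℕ | ∃ S : Finset (Fin n), S.card + d = n ∧
    ∃ b : Module.Basis (Fin n) ℤ Λ, ∀ i ∈ S, (b i : Fin n → ℝ) = e i}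

/-- The octahedron of the frame `e`. -/
def octahedron {n : ℕ} (e : Fin n → Fin n → ℝ) : Set (Fin n → ℝ) :=
  {x | ∃ c : Fin n → ℝ, x = ∑ i, c i • e i ∧ ∑ i, |c i| ≤ 1}

/-- The octahedron of the frame `e` is admissible with respect to `Λ`: its only lattice points are
the origin and the vectors `± e i`. -/
def IsAdmissible {n : ℕ} (e : Fin n → Fin n → ℝ) (Λ : Submodule ℤ (Fin n → ℝ)) : Prop :=
  octahedron e ∩ (Λ : Set (Fin n → ℝ)) =
    {0} ∪ Set.range e ∪ Set.range (fun i => -e i)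

/-- The standard frame of `ℤⁿ`. -/
def stdFrame (n : ℕ) : Fin n → Fin n → ℝ := fun i => Pi.single i 1

/-- The lattice `⟨ℤⁿ, a₁, …, aₘ⟩` generated over `ℤ` by the standard frame and the rational
vectors `a₁, …, aₘ`. -/
def centering {n m : ℕ} (a : Fin m → Fin n → ℚ) : Submodule ℤ (Fin n → ℝ) :=
  Submodule.span ℤ
    (Set.range (stdFrame n) ∪ Set.range (fun (k : Fin m) (j : Fin n) => ((a k j : ℚ) : ℝ)))

/-- The set of all centerings of `ℤⁿ` obtained by adjoining `m` rational vectors. -/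
def rationalCenterings (n m : ℕ) : Set (Submodule ℤ (Fin n → ℝ)) :=
  {Λ | ∃ a : Fin m → Fin n → ℚ, Λ = centering a}

/-- The defects of the admissible standard octahedra in centerings obtained by adjoining `m`
rational vectors to `ℤⁿ`. -/
def admissibleDefects (n m : ℕ) : Set ℕ :=
  {d | ∃ Λ ∈ rationalCenterings n m, IsAdmissible (stdFrame n) Λ ∧ d = frameDefect (stdFrame n) Λ}

/-- The quantity `d_n^m`: the largest defect of the standard octahedron over all centerings
obtained by adjoining `m` rational vectors to `ℤⁿ` in which it is admissible
(a maximum, see `maxDefect_isGreatest`). -/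
noncomputable def maxDefect (n m : ℕ) : ℕ := sSup (admissibleDefects n m)

theorem stdFrame_linearIndependent (n : ℕ) : LinearIndependent ℤ (stdFrame n) := by
  have h1 := (Pi.basisFun ℝ (Fin n)).linearIndependent
  have h2 : (⇑(Pi.basisFun ℝ (Fin n))) = stdFrame n := by
    funext i
    simp [stdFrame]
  rw [h2] at h1
  exact h1.restrict_scalars' ℤ

theorem mem_span_stdFrame {n : ℕ} (x : Fin n → ℝ) :
    x ∈ Submodule.span ℤ (Set.range (stdFrame n)) ↔ ∃ c : Fin n → ℤ, ∀ i, x i = c i := by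
  rw [Submodule.mem_span_range_iff_exists_fun]
  have key : ∀ c : Fin n → ℤ, (∑ i, c i • stdFrame n i) = fun i => (c i : ℝ) := by
    intro c
    funext j
    simp [stdFrame, Finset.sum_apply, Pi.single_apply]
  constructor
  · rintro ⟨c, rfl⟩
    exact ⟨c, fun i => by rw [key]⟩
  · rintro ⟨c, hc⟩
    exact ⟨c, by rw [key]; funext i; exact (hc i).symm⟩

/-- A rational centering is a lattice of rank `n`. -/
theorem nonempty_basis_centering {n m : ℕ} (a : Fin m → Fin n → ℚ) :
    Nonempty (Module.Basis (Fin n) ℤ (centering a)) := by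
  have hfin : Module.Finite ℤ (centering a) :=
    Module.Finite.iff_fg.2 (Submodule.fg_span ((Set.finite_range _).union (Set.finite_range _)))
  have hfinL : Module.Finite ℤ (Submodule.span ℤ (Set.range (stdFrame n))) :=
    Module.Finite.iff_fg.2 (Submodule.fg_span (Set.finite_range _))
  have hrk : Module.finrank ℤ (Submodule.span ℤ (Set.range (stdFrame n))) = n := by
    rw [finrank_span_eq_card (stdFrame_linearIndependent n), Fintype.card_fin]
  have hle : Submodule.span ℤ (Set.range (stdFrame n)) ≤ centering a :=
    Submodule.span_mono Set.subset_union_left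
  have h1 : n ≤ Module.finrank ℤ (centering a) := by
    have := Submodule.finrank_mono hle
    omega
  obtain ⟨q, hq0, hq⟩ : ∃ q : ℤ, q ≠ 0 ∧ ∀ x ∈ centering a,
      q • x ∈ Submodule.span ℤ (Set.range (stdFrame n)) := by
    refine ⟨∏ k, ∏ j, ((a k j).den : ℤ), ?_, ?_⟩
    · exact Finset.prod_ne_zero_iff.2 fun k _ => Finset.prod_ne_zero_iff.2 fun j _ => by
        exact_mod_cast (a k j).den_nz
    · intro x hx
      have hs : centering a ≤ (Submodule.span ℤ (Set.range (stdFrame n))).comap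
          (LinearMap.lsmul ℤ (Fin n → ℝ) (∏ k, ∏ j, ((a k j).den : ℤ))) := by
        refine Submodule.span_le.2 ?_
        rintro y (hy | ⟨k, rfl⟩)
        · exact Submodule.smul_mem _ _ (Submodule.subset_span hy)
        · refine (mem_span_stdFrame _).2 ?_
          have : ∀ j, ∃ c : ℤ, (((∏ k, ∏ j, ((a k j).den : ℤ) : ℤ) : ℝ) * ((a k j : ℚ) : ℝ)) = c := by
            intro j
            have hd : ((a k j).den : ℤ) ∣ ∏ k, ∏ j, ((a k j).den : ℤ) :=
              (Finset.dvd_prod_of_mem (fun j => ((a k j).den : ℤ)) (Finset.mem_univ j)).trans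
                (Finset.dvd_prod_of_mem (fun k => ∏ j, ((a k j).den : ℤ)) (Finset.mem_univ k))
            obtain ⟨r, hr⟩ := hd
            refine ⟨r * (a k j).num, ?_⟩
            rw [hr]
            have h2 : ((a k j).den : ℝ) * ((a k j : ℚ) : ℝ) = (a k j).num := by
              exact_mod_cast Rat.den_mul_eq_num (a k j)
            push_cast
            rw [← h2]
            ring
          choose c hc using this
          refine ⟨c, fun j => ?_⟩
          rw [← hc j]
          simp
      exact hs hx
  have h2 : Module.finrank ℤ (centering a) ≤ n := by
    let f : centering a →ₗ[ℤ] Submodule.span ℤ (Set.range (stdFrame n)) :=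
      ((LinearMap.lsmul ℤ (Fin n → ℝ) q).domRestrict (centering a)).codRestrict _
        (fun x => hq x x.2)
    have hf : Function.Injective f := by
      intro x y hxy
      have h3 : q • (x : Fin n → ℝ) = q • (y : Fin n → ℝ) := congrArg Subtype.val hxy
      exact Subtype.ext (smul_right_injective _ hq0 h3)
    have := LinearMap.finrank_le_finrank_of_injective hf
    omega
  exact ⟨Module.finBasisOfFinrankEq ℤ _ (le_antisymm h2 h1)⟩

/-- For a rational centering, the minimum in the definition of the defect is attained. -/
theorem frameDefect_mem {n m : ℕ} (e : Fin n → Fin n → ℝ) (a : Fin m → Fin n → ℚ) :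
    ∃ S : Finset (Fin n), S.card + frameDefect e (centering a) = n ∧
      ∃ b : Module.Basis (Fin n) ℤ (centering a), ∀ i ∈ S, (b i : Fin n → ℝ) = e i := by
  obtain ⟨b⟩ := nonempty_basis_centering a
  exact Nat.sInf_mem (s := {d : ℕ | ∃ S : Finset (Fin n), S.card + d = n ∧
    ∃ b : Module.Basis (Fin n) ℤ (centering a), ∀ i ∈ S, (b i : Fin n → ℝ) = e i})
    ⟨n, ∅, by simp, b, by simp⟩

/-- The standard octahedron is admissible with respect to `ℤⁿ` itself. -/
theorem isAdmissible_centering_zero (n m : ℕ) :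
    IsAdmissible (stdFrame n) (centering (0 : Fin m → Fin n → ℚ)) := by
  have hc : centering (0 : Fin m → Fin n → ℚ) = Submodule.span ℤ (Set.range (stdFrame n)) := by
    refine le_antisymm (Submodule.span_le.2 ?_) (Submodule.span_mono Set.subset_union_left)
    rintro y (hy | ⟨k, rfl⟩)
    · exact Submodule.subset_span hy
    · have h0 : (fun j : Fin n => (((0 : Fin m → Fin n → ℚ) k j : ℚ) : ℝ)) = 0 := by
        funext j; simp
      show (fun j : Fin n => (((0 : Fin m → Fin n → ℚ) k j : ℚ) : ℝ)) ∈ _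
      rw [h0]
      exact Submodule.zero_mem _
  have hsum : ∀ c : Fin n → ℝ, (∑ i, c i • stdFrame n i) = c := by
    intro c
    funext j
    simp [stdFrame, Finset.sum_apply, Pi.single_apply]
  unfold IsAdmissible
  rw [hc]
  ext x
  constructor
  · rintro ⟨⟨c, rfl, hc1⟩, hx⟩
    rw [hsum] at hx ⊢
    obtain ⟨z, hz⟩ := (mem_span_stdFrame _).1 hx
    by_cases h0 : c = 0
    · exact Or.inl (Or.inl h0)
    obtain ⟨i, hi⟩ := Function.ne_iff.1 h0
    have hzi : z i ≠ 0 := by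
      intro h; apply hi; rw [hz i, h]; simp
    have h1 : (1 : ℝ) ≤ |c i| := by
      rw [hz i]; exact_mod_cast Int.one_le_abs hzi
    have hsplit := Finset.add_sum_erase Finset.univ (fun j => |c j|) (Finset.mem_univ i)
    have hrest : ∑ j ∈ Finset.univ.erase i, |c j| = 0 :=
      le_antisymm (by linarith) (Finset.sum_nonneg fun _ _ => abs_nonneg _)
    have hci : |c i| = 1 := by
      linarith
    have hj : ∀ j, j ≠ i → c j = 0 := fun j hji => abs_eq_zero.1
      ((Finset.sum_eq_zero_iff_of_nonneg fun _ _ => abs_nonneg _).1 hrest j (by simp [hji]))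
    rcases (abs_eq zero_le_one).1 hci with h | h
    · refine Or.inl (Or.inr ⟨i, ?_⟩)
      funext j
      by_cases hji : j = i
      · subst hji; simp [stdFrame, h]
      · simp [stdFrame, hj j hji, hji]
    · refine Or.inr ⟨i, ?_⟩
      funext j
      by_cases hji : j = i
      · subst hji; simp [stdFrame, h]
      · simp [stdFrame, hj j hji, hji]
  · have habs : ∀ i, ∑ j, |stdFrame n i j| = 1 := by
      intro i
      rw [Finset.sum_eq_single i] <;> simp +contextual [stdFrame]
    rintro ((rfl | ⟨i, rfl⟩) | ⟨i, rfl⟩)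
    · exact ⟨⟨0, by simp, by simp⟩, Submodule.zero_mem _⟩
    · exact ⟨⟨stdFrame n i, (hsum _).symm, (habs i).le⟩,
        Submodule.subset_span ⟨i, rfl⟩⟩
    · exact ⟨⟨-stdFrame n i, (hsum _).symm, by simpa using (habs i).le⟩,
        Submodule.neg_mem _ (Submodule.subset_span ⟨i, rfl⟩)⟩

/-- The quantity `d_n^m` is a genuine maximum. -/
theorem maxDefect_isGreatest (n m : ℕ) : IsGreatest (admissibleDefects n m) (maxDefect n m) := by
  have hb : ∀ d ∈ admissibleDefects n m, d ≤ n := by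
    rintro d ⟨Λ, ⟨a, rfl⟩, -, rfl⟩
    obtain ⟨S, hS, -⟩ := frameDefect_mem (stdFrame n) a
    omega
  have hbdd : BddAbove (admissibleDefects n m) := ⟨n, hb⟩
  exact ⟨Nat.sSup_mem ⟨_, _, ⟨0, rfl⟩, isAdmissible_centering_zero n m, rfl⟩ hbdd,
    fun d hd => le_csSup hbdd hd⟩

/-! The finite group `G = Λ / ℤⁿ` is a set of points of the torus, and its coordinates are
characters. Admissibility says that the distances of the coordinates of a nonzero point to the
nearest integers add up to more than 1. If only the coordinates in `T` are needed to recognise the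
zero of `G`, the frame vectors outside `T` span a saturated sublattice of `Λ` and extend to a basis,
so the defect is at most `|T|` (`frameDefect_le_card`). It remains to find a small separating `T`.

For a prime `p` let `r_p(T)` be the rank of the `p`-torsion killed by `T`; `T` separates `G` once
all these ranks vanish. By pigeonhole, a subgroup supported on `s` coordinates has at most `s ^ s`
elements. Hence for `p ≥ y` a rank `r ≤ m` forces a support of at least `σ r` coordinates, where `σ`
is about `log y / log (m log y)`. By averaging, some coordinate cuts the total rank over primes `p ≥
y` by the factor `1 - σ / n`, so `k` greedy choices reduce it by `exp (-k σ / n)`. The initial total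
is at most `n log n / log y`, by pigeonhole for all of `G`. The primes below `y` contribute rank at
most `m y`. Each remaining unit of rank costs one more coordinate (`exists_separating_card_le`).

With `y = √(n/m)` this gives the bound when `n/m` is large and `m ≤ n/m`. Otherwise the trivial
bound `d ≤ n` suffices. -/

/-! ### Pigeonhole principle on the torus -/

/-- Elements of the unit circle whose representatives in `[0, 1)` fall into the same of `N` equal
cells are at distance less than `1 / N`. -/
theorem norm_sub_lt_of_floor_eq {N : ℕ} (hN : 0 < N) (x y : UnitAddCircle)
    (h : ⌊(N : ℝ) * (AddCircle.equivIco 1 0 x : ℝ)⌋₊ = ⌊(N : ℝ) * (AddCircle.equivIco 1 0 y : ℝ)⌋₊) :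
    ‖x - y‖ < 1 / N := by
  obtain ⟨u, hu, hux⟩ : ∃ u : ℝ, 0 ≤ u ∧ (AddCircle.equivIco 1 0 x : ℝ) = u :=
    ⟨_, (AddCircle.equivIco 1 0 x).2.1, rfl⟩
  obtain ⟨v, hv, hvy⟩ : ∃ v : ℝ, 0 ≤ v ∧ (AddCircle.equivIco 1 0 y : ℝ) = v :=
    ⟨_, (AddCircle.equivIco 1 0 y).2.1, rfl⟩
  have hx : x = (u : UnitAddCircle) := by rw [← hux]; exact (AddCircle.coe_equivIco).symm
  have hy : y = (v : UnitAddCircle) := by rw [← hvy]; exact (AddCircle.coe_equivIco).symm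
  rw [hux, hvy] at h
  have hN' : (0 : ℝ) < N := by exact_mod_cast hN
  have h1 := Nat.floor_le (mul_nonneg hN'.le hu)
  have h2 := Nat.lt_floor_add_one ((N : ℝ) * u)
  have h3 := Nat.floor_le (mul_nonneg hN'.le hv)
  have h4 := Nat.lt_floor_add_one ((N : ℝ) * v)
  rw [h] at h1 h2
  have h5 : |u - v| < 1 / N := by
    rw [abs_lt, lt_div_iff₀ hN', ← neg_div, div_lt_iff₀ hN']
    constructor <;> linarith
  have h6 : ‖x - y‖ ≤ |u - v| := by
    rw [hx, hy, ← AddCircle.coe_sub, UnitAddCircle.norm_eq]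
    simpa using round_le (u - v) 0
  exact h6.trans_lt h5

theorem floor_mul_equivIco_lt {N : ℕ} (hN : 0 < N) (x : UnitAddCircle) :
    ⌊(N : ℝ) * (AddCircle.equivIco 1 0 x : ℝ)⌋₊ < N := by
  have hN' : (0 : ℝ) < N := by exact_mod_cast hN
  have h0 := (AddCircle.equivIco 1 0 x).2.1
  have h1 : (AddCircle.equivIco 1 0 x : ℝ) < 1 := by
    have := (AddCircle.equivIco (1 : ℝ) 0 x).2.2
    linarith
  rw [Nat.floor_lt (mul_nonneg hN'.le h0)]
  nlinarith

section Group

variable {ι G : Type*} [AddCommGroup G]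

/-- **Pigeonhole principle** for a group of points of a torus, no nonzero element of which is
close to the origin. -/
theorem finite_and_card_le_of_one_lt_sum_norm (s : Finset ι) (ψ : ι → G →+ UnitAddCircle)
    (h : ∀ g : G, g ≠ 0 → 1 < ∑ j ∈ s, ‖ψ j g‖) :
    Finite G ∧ Nat.card G ≤ s.card ^ s.card := by
  have hpos : ∀ j : s, 0 < s.card := fun j => Finset.card_pos.2 ⟨j, j.2⟩
  let f : G → s → Fin s.card := fun g j =>
    ⟨⌊(s.card : ℝ) * (AddCircle.equivIco 1 0 (ψ j g) : ℝ)⌋₊, floor_mul_equivIco_lt (hpos j) _⟩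
  have hf : Function.Injective f := by
    intro g g' hg
    by_contra hne
    have h1 := h (g - g') (sub_ne_zero.2 hne)
    have h2 : ∑ j ∈ s, ‖ψ j (g - g')‖ ≤ ∑ j ∈ s, (1 / s.card : ℝ) := by
      refine Finset.sum_le_sum fun j hj => ?_
      rw [map_sub]
      exact (norm_sub_lt_of_floor_eq (hpos ⟨j, hj⟩) _ _
        (congrArg Fin.val (congrFun hg ⟨j, hj⟩))).le
    rw [Finset.sum_const, nsmul_eq_mul] at h2
    -- Only `≤` is available, since for empty `s` the left side is `0`.
    have h3 : (s.card : ℝ) * (1 / s.card) ≤ 1 := by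
      rw [mul_one_div]; exact div_self_le_one _
    linarith
  refine ⟨Finite.of_injective f hf, ?_⟩
  refine (Nat.card_le_card_of_injective f hf).trans_eq ?_
  rw [Nat.card_fun, Nat.card_eq_fintype_card, Nat.card_eq_fintype_card, Fintype.card_coe,
    Fintype.card_fin]

/-! ### Torsion subgroups cut out by characters, and their ranks -/

variable (χ : ι → G →+ UnitAddCircle)

/-- The `p`-torsion elements killed by the characters indexed by `T`. -/
def torsionKer (p : ℕ) (T : Finset ι) : AddSubgroup G where
  carrier := {g | p • g = 0 ∧ ∀ j ∈ T, χ j g = 0}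
  zero_mem' := by simp
  add_mem' := by
    rintro a b ⟨ha, ha'⟩ ⟨hb, hb'⟩
    exact ⟨by rw [smul_add, ha, hb, add_zero], fun j hj => by
      rw [map_add, ha' j hj, hb' j hj, add_zero]⟩
  neg_mem' := by
    rintro a ⟨ha, ha'⟩
    exact ⟨by rw [smul_neg, ha, neg_zero], fun j hj => by rw [map_neg, ha' j hj, neg_zero]⟩

theorem mem_torsionKer {p : ℕ} {T : Finset ι} {g : G} :
    g ∈ torsionKer χ p T ↔ p • g = 0 ∧ ∀ j ∈ T, χ j g = 0 := Iff.rfl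

/-- The dimension over `𝔽_p` of `torsionKer χ p T`. -/
noncomputable def torsionRank (p : ℕ) (T : Finset ι) : ℕ := Nat.log p (Nat.card (torsionKer χ p T))

theorem torsionKer_anti {p : ℕ} {T T' : Finset ι} (h : T ⊆ T') :
    torsionKer χ p T' ≤ torsionKer χ p T :=
  fun _ hg => ⟨hg.1, fun j hj => hg.2 j (h hj)⟩

theorem exists_ne_zero_of_torsionRank_pos {p : ℕ} {T : Finset ι} (h : 0 < torsionRank χ p T) :
    ∃ g ∈ torsionKer χ p T, g ≠ 0 := by
  by_contra! hc
  have : torsionKer χ p T = ⊥ := (AddSubgroup.eq_bot_iff_forall _).2 hc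
  simp [torsionRank, this] at h

section Finite

variable [Finite G] {p : ℕ}

/-- The subgroup has exponent dividing `p`, so its order is an exact power of `p` and the rounding
in `Nat.log` loses nothing. -/
theorem card_torsionKer (hp : p.Prime) (T : Finset ι) :
    Nat.card (torsionKer χ p T) = p ^ torsionRank χ p T := by
  have := Fact.mk hp
  have h : IsPGroup p (Multiplicative (torsionKer χ p T)) := fun g => ⟨1, by
    apply Multiplicative.toAdd.injective
    apply Subtype.ext
    simpa using (Multiplicative.toAdd g).2.1⟩
  obtain ⟨r, hr⟩ := IsPGroup.iff_card.1 h
  have hr' : Nat.card (torsionKer χ p T) = p ^ r := hr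
  rw [torsionRank, hr', Nat.log_pow hp.one_lt]

theorem torsionRank_anti {T T' : Finset ι} (h : T ⊆ T') :
    torsionRank χ p T' ≤ torsionRank χ p T :=
  Nat.log_mono_right (Nat.card_le_card_of_injective _
    (AddSubgroup.inclusion_injective (torsionKer_anti χ h)))

theorem torsionRank_insert_lt [DecidableEq ι] (hp : p.Prime) {T : Finset ι} {j : ι}
    (h : ∃ g ∈ torsionKer χ p T, χ j g ≠ 0) :
    torsionRank χ p (insert j T) < torsionRank χ p T := by
  refine lt_of_le_of_ne (torsionRank_anti χ (Finset.subset_insert j T)) fun he => ?_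
  obtain ⟨g, hg, hj⟩ := h
  have hc : Nat.card (torsionKer χ p (insert j T)) = Nat.card (torsionKer χ p T) := by
    rw [card_torsionKer χ hp, card_torsionKer χ hp, he]
  have := AddSubgroup.eq_of_le_of_card_ge (torsionKer_anti χ (Finset.subset_insert j T)) hc.ge
  rw [← this] at hg
  exact hj (hg.2 j (Finset.mem_insert_self j T))

/-- A nonzero element killed by `T` has a multiple of prime order `p`, also killed by `T`, and `p`
divides `|G|` by Lagrange. So vanishing ranks mean that `T` separates `G`. -/
theorem eq_zero_of_torsionRank_eq_zero {T : Finset ι}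
    (h : ∀ p : ℕ, p.Prime → p ∣ Nat.card G → torsionRank χ p T = 0) {g : G}
    (hg : ∀ j ∈ T, χ j g = 0) : g = 0 := by
  by_contra hne
  have h1 : addOrderOf g ≠ 1 := fun h => hne (AddMonoid.addOrderOf_eq_one_iff.1 h)
  obtain ⟨p, hp, k, hk⟩ := Nat.exists_prime_and_dvd h1
  have hpos : 0 < addOrderOf g := addOrderOf_pos g
  have hr := h p hp ((Dvd.intro k hk.symm).trans (addOrderOf_dvd_natCard g))
  have hmem : k • g ∈ torsionKer χ p T :=
    ⟨by rw [smul_smul, ← hk, addOrderOf_nsmul_eq_zero], fun j hj => by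
      rw [map_nsmul, hg j hj, smul_zero]⟩
  have hc : Nat.card (torsionKer χ p T) = 1 := by rw [card_torsionKer χ hp, hr, pow_zero]
  rw [AddSubgroup.card_eq_one.1 hc, AddSubgroup.mem_bot] at hmem
  have hdvd := addOrderOf_dvd_of_nsmul_eq_zero hmem
  have hk0 : 0 < k := Nat.pos_of_ne_zero fun h0 => by
    rw [h0, mul_zero] at hk; omega
  have := Nat.le_of_dvd hk0 hdvd
  have := hp.two_le
  nlinarith

/-- The `p`-rank of a group is at most the number of its generators. -/
theorem torsionRank_le_of_generators {m : ℕ} (a : Fin m → G)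
    (ha : ∀ g, ∃ k : Fin m → ℤ, g = ∑ i, k i • a i) (hp : p.Prime) (T : Finset ι) :
    torsionRank χ p T ≤ m := by
  let f : G →+ G := nsmulAddMonoidHom p
  -- For finite `G` the `p`-torsion has as many elements as `G / pG`, and the latter is covered by
  -- combinations of the generators with coefficients in `[0, p)`.
  have h1 : Nat.card f.ker = f.range.index := by
    have e1 := f.ker.card_mul_index
    have e2 := f.range.card_mul_index
    rw [AddSubgroup.index_ker] at e1
    have : 0 < Nat.card f.range := Nat.card_pos
    nlinarith
  have h2 : f.range.index ≤ p ^ m := by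
    have : NeZero p := ⟨hp.ne_zero⟩
    let φ : (Fin m → Fin p) → G ⧸ f.range := fun k => ((∑ i, (k i : ℕ) • a i : G) : G ⧸ f.range)
    have hφ : Function.Surjective φ := by
      intro x
      obtain ⟨g, rfl⟩ := QuotientAddGroup.mk_surjective x
      obtain ⟨k, rfl⟩ := ha g
      have hp0 : (0 : ℤ) < p := by exact_mod_cast hp.pos
      refine ⟨fun i => ⟨(k i % p).toNat, by
        have := Int.emod_lt_of_pos (k i) hp0
        have := Int.emod_nonneg (k i) hp0.ne'
        omega⟩, ?_⟩
      refine QuotientAddGroup.eq.2 ⟨∑ i, (k i / p) • a i, ?_⟩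
      show p • (∑ i, (k i / p) • a i) = _
      rw [Finset.smul_sum, ← Finset.sum_neg_distrib, ← Finset.sum_add_distrib]
      refine Finset.sum_congr rfl fun i _ => ?_
      have e : (((k i % p).toNat : ℕ) : ℤ) = k i % p :=
        Int.toNat_of_nonneg (Int.emod_nonneg (k i) hp0.ne')
      rw [← natCast_zsmul (a i), e, ← natCast_zsmul, smul_smul, ← neg_smul, ← add_smul]
      congr 1
      have := Int.mul_ediv_add_emod (k i) p
      linarith
    have := Nat.card_le_card_of_surjective φ hφ
    simpa [AddSubgroup.index] using this
  have h3 : Nat.card (torsionKer χ p T) ≤ Nat.card f.ker :=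
    Nat.card_le_card_of_injective _
      (AddSubgroup.inclusion_injective (K := f.ker) fun _ hg => ((mem_torsionKer χ).1 hg).1)
  rw [card_torsionKer χ hp] at h3
  exact (Nat.pow_le_pow_iff_right hp.one_lt).1 (by omega)

/-- The factors are orders of subgroups, hence divide `|G|`, and are coprime for distinct primes. -/
theorem prod_pow_torsionRank_le (P : Finset ℕ) (hP : ∀ p ∈ P, p.Prime) (T : Finset ι) :
    ∏ p ∈ P, p ^ torsionRank χ p T ≤ Nat.card G := by
  refine Nat.le_of_dvd Nat.card_pos (Finset.prod_dvd_of_isRelPrime ?_ ?_)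
  · intro p hp q hq hpq
    exact Nat.coprime_iff_isRelPrime.1 (Nat.Coprime.pow _ _
      ((Nat.coprime_primes (hP p hp) (hP q hq)).2 hpq))
  · intro p hp
    rw [← card_torsionKer χ (hP p hp)]
    exact AddSubgroup.card_addSubgroup_dvd_card _

end Finite

end Group

/-! ### Greedy choice of separating coordinates -/

section Greedy

variable {ι G : Type*} [AddCommGroup G] (χ : ι → G →+ UnitAddCircle)

/-- The sum over `p ∈ P` of the ranks of `torsionKer χ p T`. -/
noncomputable def totalRank (P : Finset ℕ) (T : Finset ι) : ℕ := ∑ p ∈ P, torsionRank χ p T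

open scoped Classical in
/-- The indices of the characters that are not trivial on `torsionKer χ p T`. -/
noncomputable def torsionSupport [Fintype ι] (p : ℕ) (T : Finset ι) : Finset ι :=
  {j | ∃ g ∈ torsionKer χ p T, χ j g ≠ 0}

theorem mem_torsionSupport [Fintype ι] {p : ℕ} {T : Finset ι} {j : ι} :
    j ∈ torsionSupport χ p T ↔ ∃ g ∈ torsionKer χ p T, χ j g ≠ 0 := by
  simp [torsionSupport]

theorem sum_norm_torsionSupport [Fintype ι] {p : ℕ} {T : Finset ι} {g : G}
    (hg : g ∈ torsionKer χ p T) :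
    ∑ j ∈ torsionSupport χ p T, ‖χ j g‖ = ∑ j, ‖χ j g‖ := by
  refine Finset.sum_subset (Finset.subset_univ _) fun j _ hj => ?_
  rw [mem_torsionSupport] at hj
  push Not at hj
  rw [hj g hg, norm_zero]

variable [Finite G]

/-- Characters outside the support contribute nothing to the norm sum on this subgroup, so the
pigeonhole principle needs only the support coordinates. -/
theorem pow_torsionRank_le [Fintype ι] (hχ : ∀ g : G, g ≠ 0 → 1 < ∑ j, ‖χ j g‖)
    {p : ℕ} (hp : p.Prime) (T : Finset ι) :
    p ^ torsionRank χ p T ≤ (torsionSupport χ p T).card ^ (torsionSupport χ p T).card := by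
  rw [← card_torsionKer χ hp]
  refine (finite_and_card_le_of_one_lt_sum_norm (torsionSupport χ p T)
    (fun j => (χ j).comp (torsionKer χ p T).subtype) fun g hg => ?_).2
  have h := hχ g (by simpa using hg)
  rw [← sum_norm_torsionSupport χ g.2] at h
  exact h

/-- If `s ^ s` is at least `y ^ r`, then `s` is at least of the order `r log y / log (r log y)`. -/
theorem mul_log_div_le_of_pow_le {y D : ℝ} {r m s : ℕ} (hy : 1 < y) (hr : r ≤ m) (hD : 1 ≤ D)
    (hmD : Real.log (m * Real.log y) ≤ D) (h : y ^ r ≤ (s : ℝ) ^ s) :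
    Real.log y / D * r ≤ s := by
  have hD0 : 0 < D := by linarith
  have hly : 0 < Real.log y := Real.log_pos hy
  rw [div_mul_eq_mul_div, div_le_iff₀ hD0]
  rcases Nat.eq_zero_or_pos r with rfl | hr0
  · simp only [Nat.cast_zero, mul_zero]; positivity
  -- If `s ≥ r log y`, then `D ≥ 1` suffices. Otherwise `s < m log y`, so `log s ≤ D`, and `r log y
  -- ≤ s log s ≤ s D`.
  have hX : 0 < Real.log y * r := by positivity
  by_cases hs : Real.log y * r ≤ s
  · nlinarith [Nat.cast_nonneg (α := ℝ) s]
  push Not at hs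
  have h1 := Real.log_le_log (by positivity) h
  rw [Real.log_pow, Real.log_pow] at h1
  have hs0 : (0 : ℝ) < s := by
    by_contra hc
    have : (s : ℝ) = 0 := le_antisymm (not_lt.1 hc) (Nat.cast_nonneg s)
    rw [this] at h1
    nlinarith
  have h2 : Real.log s ≤ D := by
    refine (Real.log_le_log hs0 (hs.le.trans ?_)).trans hmD
    have : (r : ℝ) ≤ m := by exact_mod_cast hr
    nlinarith
  nlinarith

/-- Every unit of rank can be removed by adjoining one index. -/
theorem exists_totalRank_eq_zero {P : Finset ℕ} (hP : ∀ p ∈ P, p.Prime)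
    (hχ : ∀ g : G, g ≠ 0 → ∃ j, χ j g ≠ 0) (T : Finset ι) :
    ∃ T' : Finset ι, T'.card ≤ T.card + totalRank χ P T ∧ totalRank χ P T' = 0 := by
  classical
  induction hN : totalRank χ P T using Nat.strong_induction_on generalizing T with
  | _ N ih =>
    rcases Nat.eq_zero_or_pos N with rfl | hpos
    · exact ⟨T, by simp, hN⟩
    obtain ⟨p, hp, hpr⟩ : ∃ p ∈ P, torsionRank χ p T ≠ 0 := by
      by_contra! hc
      rw [totalRank, Finset.sum_eq_zero hc] at hN
      omega
    obtain ⟨g, hg, hg0⟩ := exists_ne_zero_of_torsionRank_pos χ (Nat.pos_of_ne_zero hpr)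
    obtain ⟨j, hj⟩ := hχ g hg0
    have hlt : totalRank χ P (insert j T) < totalRank χ P T :=
      Finset.sum_lt_sum (fun q _ => torsionRank_anti χ (Finset.subset_insert j T))
        ⟨p, hp, torsionRank_insert_lt χ (hP p hp) ⟨g, hg, hj⟩⟩
    obtain ⟨T', h1, h2⟩ := ih _ (hN ▸ hlt) (insert j T) rfl
    have := Finset.card_insert_le j T
    exact ⟨T', by omega, h2⟩

/-- Double counting: adjoining `j` lowers the rank at `p` by at least one whenever `j` lies in the
support at `p`. Summed over `j`, the drops are at least the sum of the support sizes, hence at least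
`σ` times the total rank, and some `j` does at least as well as the average. -/
theorem exists_totalRank_insert_le [Fintype ι] [Nonempty ι] [DecidableEq ι] {P : Finset ℕ}
    (hP : ∀ p ∈ P, p.Prime) {σ : ℝ} (T : Finset ι)
    (hσ : ∀ p ∈ P, σ * torsionRank χ p T ≤ (torsionSupport χ p T).card) :
    ∃ j, (totalRank χ P (insert j T) : ℝ) ≤
      totalRank χ P T * Real.exp (-(σ / Fintype.card ι)) := by
  have hn : (0 : ℝ) < Fintype.card ι := by exact_mod_cast Fintype.card_pos
  obtain ⟨j, hj⟩ : ∃ j, (totalRank χ P (insert j T) : ℝ) ≤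
      totalRank χ P T * (1 - σ / Fintype.card ι) := by
    by_contra! hc
    have h1 := Finset.sum_lt_sum_of_nonempty Finset.univ_nonempty fun j _ => hc j
    rw [Finset.sum_const, Finset.card_univ, nsmul_eq_mul] at h1
    have h2 : ∀ j, totalRank χ P (insert j T) +
        ∑ p ∈ P, (if j ∈ torsionSupport χ p T then 1 else 0) ≤ totalRank χ P T := by
      intro j
      rw [totalRank, totalRank, ← Finset.sum_add_distrib]
      refine Finset.sum_le_sum fun p hp => ?_
      split_ifs with h
      · exact torsionRank_insert_lt χ (hP p hp) ((mem_torsionSupport χ).1 h)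
      · exact torsionRank_anti χ (Finset.subset_insert j T)
    have h3 := Finset.sum_le_sum fun j (_ : j ∈ Finset.univ) => h2 j
    rw [Finset.sum_add_distrib, Finset.sum_comm, Finset.sum_const, Finset.card_univ,
      smul_eq_mul] at h3
    simp only [Finset.sum_ite_mem, Finset.univ_inter, Finset.sum_const, smul_eq_mul, mul_one] at h3
    have h3' : (∑ j, (totalRank χ P (insert j T) : ℝ)) + ∑ p ∈ P, ((torsionSupport χ p T).card : ℝ)
        ≤ Fintype.card ι * totalRank χ P T := by exact_mod_cast h3
    have h4 := Finset.sum_le_sum hσ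
    rw [← Finset.mul_sum] at h4
    have h5 : (∑ p ∈ P, (torsionRank χ p T : ℝ)) = totalRank χ P T := by
      rw [totalRank, Nat.cast_sum]
    rw [h5] at h4
    have h6 : (Fintype.card ι : ℝ) * (totalRank χ P T * (1 - σ / Fintype.card ι)) =
        Fintype.card ι * totalRank χ P T - σ * totalRank χ P T := by
      field_simp
    rw [h6] at h1
    linarith
  refine ⟨j, hj.trans (mul_le_mul_of_nonneg_left ?_ (Nat.cast_nonneg _))⟩
  have := Real.add_one_le_exp (-(σ / Fintype.card ι))
  linarith

theorem exists_totalRank_le_exp [Fintype ι] [Nonempty ι] {P : Finset ℕ}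
    (hP : ∀ p ∈ P, p.Prime) {σ : ℝ}
    (hσ : ∀ T, ∀ p ∈ P, σ * torsionRank χ p T ≤ (torsionSupport χ p T).card) (k : ℕ) :
    ∃ T : Finset ι, T.card ≤ k ∧ (totalRank χ P T : ℝ) ≤
      totalRank χ P ∅ * Real.exp (-(k * (σ / Fintype.card ι))) := by
  classical
  induction k with
  | zero => exact ⟨∅, by simp, by simp⟩
  | succ k ih =>
    obtain ⟨T, h1, h2⟩ := ih
    obtain ⟨j, hj⟩ := exists_totalRank_insert_le χ hP T (hσ T)
    have := Finset.card_insert_le j T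
    refine ⟨insert j T, by omega, hj.trans ?_⟩
    have h3 : -(((k + 1 : ℕ) : ℝ) * (σ / Fintype.card ι)) =
        -(k * (σ / Fintype.card ι)) + -(σ / Fintype.card ι) := by push_cast; ring
    rw [h3, Real.exp_add, ← mul_assoc]
    exact mul_le_mul_of_nonneg_right h2 (Real.exp_pos _).le

/-- Each unit of rank at a prime `p ≥ y` contributes a factor at least `y` to `|G|`, which is at
most `n ^ n` by pigeonhole in all `n` coordinates. -/
theorem totalRank_mul_log_le [Fintype ι] (hχ : ∀ g : G, g ≠ 0 → 1 < ∑ j, ‖χ j g‖)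
    {P : Finset ℕ} (hP : ∀ p ∈ P, p.Prime) {y : ℝ} (hy : 0 < y) (hPy : ∀ p ∈ P, y ≤ p) :
    totalRank χ P ∅ * Real.log y ≤ Fintype.card ι * Real.log (Fintype.card ι) := by
  have h1 := prod_pow_torsionRank_le χ P hP ∅
  have h2 : Nat.card G ≤ Fintype.card ι ^ Fintype.card ι :=
    (finite_and_card_le_of_one_lt_sum_norm Finset.univ χ hχ).2
  have h3 : ((∏ p ∈ P, p ^ torsionRank χ p ∅ : ℕ) : ℝ) ≤
      (Fintype.card ι : ℝ) ^ Fintype.card ι := by exact_mod_cast h1.trans h2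
  have h4 : y ^ totalRank χ P ∅ ≤ (Fintype.card ι : ℝ) ^ Fintype.card ι := by
    refine le_trans ?_ h3
    rw [totalRank, ← Finset.prod_pow_eq_pow_sum, Nat.cast_prod]
    refine Finset.prod_le_prod (fun p _ => by positivity) fun p hp => ?_
    rw [Nat.cast_pow]
    exact pow_le_pow_left₀ hy.le (hPy p hp) _
  have h5 := Real.log_le_log (by positivity) h4
  rwa [Real.log_pow, Real.log_pow] at h5

/-- A group of points of an `n`-dimensional torus without nonzero elements near the origin is
separated by few of the coordinates. -/
theorem exists_separating_card_le [Fintype ι] [Nonempty ι]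
    (hχ : ∀ g : G, g ≠ 0 → 1 < ∑ j, ‖χ j g‖) {m : ℕ} (a : Fin m → G)
    (ha : ∀ g, ∃ k : Fin m → ℤ, g = ∑ i, k i • a i) {y D : ℝ} (hy : 1 < y) (hD : 1 ≤ D)
    (hmD : Real.log (m * Real.log y) ≤ D) (k : ℕ) :
    ∃ T : Finset ι, (∀ g : G, (∀ j ∈ T, χ j g = 0) → g = 0) ∧
      (T.card : ℝ) ≤ k + Fintype.card ι * Real.log (Fintype.card ι) / Real.log y *
        Real.exp (-(k * (Real.log y / D / Fintype.card ι))) + m * y := by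
  classical
  have hly : 0 < Real.log y := Real.log_pos hy
  let P : Finset ℕ := (Nat.card G).primeFactors
  -- The greedy choice looks only at the large primes `Q`. The small ones, `R`, are fewer than or
  -- equal to `y` in number and have rank at most `m` each.
  let Q : Finset ℕ := P.filter fun p : ℕ => y ≤ p
  let R : Finset ℕ := P.filter fun p : ℕ => ¬ y ≤ p
  have hP : ∀ p ∈ P, p.Prime := fun p hp => Nat.prime_of_mem_primeFactors hp
  have hQ : ∀ p ∈ Q, p.Prime := fun p hp => hP p (Finset.mem_filter.1 hp).1
  have hR : ∀ p ∈ R, p.Prime := fun p hp => hP p (Finset.mem_filter.1 hp).1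
  have hQy : ∀ p ∈ Q, y ≤ p := fun p hp => (Finset.mem_filter.1 hp).2
  have hσ : ∀ T : Finset ι, ∀ p ∈ Q,
      Real.log y / D * torsionRank χ p T ≤ (torsionSupport χ p T).card := by
    intro T p hp
    refine mul_log_div_le_of_pow_le hy (torsionRank_le_of_generators χ a ha (hQ p hp) T) hD hmD ?_
    have h1 : ((p : ℝ)) ^ torsionRank χ p T ≤
        ((torsionSupport χ p T).card : ℝ) ^ (torsionSupport χ p T).card := by
      exact_mod_cast pow_torsionRank_le χ hχ (hQ p hp) T
    exact (pow_le_pow_left₀ (by linarith) (hQy p hp) _).trans h1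
  obtain ⟨T₀, hT₀, hT₀r⟩ := exists_totalRank_le_exp χ hQ hσ k
  have hχ' : ∀ g : G, g ≠ 0 → ∃ j, χ j g ≠ 0 := by
    intro g hg
    by_contra! hc
    have := hχ g hg
    simp only [hc, norm_zero, Finset.sum_const_zero] at this
    linarith
  -- The rank left after the greedy phase, at large and small primes alike, is removed one
  -- coordinate per unit.
  obtain ⟨T, hT, hT0⟩ := exists_totalRank_eq_zero χ hP hχ' T₀
  refine ⟨T, fun g hg => eq_zero_of_torsionRank_eq_zero χ (fun p hp hpG => ?_) hg, ?_⟩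
  · exact Finset.sum_eq_zero_iff.1 hT0 p
      (Nat.mem_primeFactors.2 ⟨hp, hpG, Nat.card_pos.ne'⟩)
  have hsplit : totalRank χ P T₀ = totalRank χ Q T₀ + totalRank χ R T₀ :=
    (Finset.sum_filter_add_sum_filter_not P (fun p : ℕ => y ≤ p) _).symm
  have hsmall : (totalRank χ R T₀ : ℝ) ≤ m * y := by
    have h1 : totalRank χ R T₀ ≤ R.card * m := by
      rw [← smul_eq_mul]
      exact Finset.sum_le_card_nsmul _ _ _ fun p hp =>
        torsionRank_le_of_generators χ a ha (hR p hp) T₀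
    have h2 : R.card ≤ ⌊y⌋₊ := by
      have : R ⊆ Finset.Ioc 0 ⌊y⌋₊ := fun p hp => Finset.mem_Ioc.2
        ⟨(hR p hp).pos, Nat.le_floor (le_of_not_ge (Finset.mem_filter.1 hp).2)⟩
      simpa using Finset.card_le_card this
    have h3 : (R.card : ℝ) ≤ y := (Nat.cast_le.2 h2).trans (Nat.floor_le (by linarith))
    have h4 : (totalRank χ R T₀ : ℝ) ≤ R.card * m := by exact_mod_cast h1
    nlinarith [Nat.cast_nonneg (α := ℝ) m]
  have hN : (totalRank χ Q ∅ : ℝ) ≤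
      Fintype.card ι * Real.log (Fintype.card ι) / Real.log y :=
    (le_div_iff₀ hly).2 (totalRank_mul_log_le χ hχ hQ (by linarith) hQy)
  have hbig := hT₀r.trans (mul_le_mul_of_nonneg_right hN (Real.exp_pos _).le)
  have hT' : (T.card : ℝ) ≤ T₀.card + (totalRank χ Q T₀ + totalRank χ R T₀) := by
    rw [hsplit] at hT; exact_mod_cast hT
  have hT₀' : (T₀.card : ℝ) ≤ k := by exact_mod_cast hT₀
  linarith

end Greedy

/-! ### From separating coordinates to the defect -/

section Lattice

variable {n m : ℕ}

theorem sum_smul_stdFrame (c : Fin n → ℝ) : ∑ i, c i • stdFrame n i = c := by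
  funext j
  simp [stdFrame, Finset.sum_apply, Pi.single_apply]

theorem span_stdFrame_le_centering (a : Fin m → Fin n → ℚ) :
    Submodule.span ℤ (Set.range (stdFrame n)) ≤ centering a :=
  Submodule.span_mono Set.subset_union_left

/-- The reduction of `ℝⁿ` modulo `ℤⁿ`. -/
noncomputable def toTorus (n : ℕ) : (Fin n → ℝ) →+ (Fin n → UnitAddCircle) where
  toFun x j := (x j : UnitAddCircle)
  map_zero' := by funext j; simp
  map_add' x y := by funext j; simp

theorem toTorus_apply_eq_zero_iff (x : Fin n → ℝ) (j : Fin n) :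
    toTorus n x j = 0 ↔ ∃ z : ℤ, x j = z := by
  show (x j : UnitAddCircle) = 0 ↔ _
  rw [AddCircle.coe_eq_zero_iff]
  simp [eq_comm]

theorem toTorus_eq_zero_iff (x : Fin n → ℝ) :
    toTorus n x = 0 ↔ x ∈ Submodule.span ℤ (Set.range (stdFrame n)) := by
  rw [mem_span_stdFrame, funext_iff]
  simp only [Pi.zero_apply, toTorus_apply_eq_zero_iff]
  exact Classical.skolem

/-- The group `Λ / ℤⁿ` of a centering `Λ`, as a group of points of the torus. -/
noncomputable def torusPoints (a : Fin m → Fin n → ℚ) : AddSubgroup (Fin n → UnitAddCircle) :=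
  (centering a).toAddSubgroup.map (toTorus n)

/-- The norm on the circle is the distance to the nearest integer. If the sum were at most 1,
rounding a representative would leave a point of `Λ` in the octahedron; such points are integral, so
the class would be zero. -/
theorem one_lt_sum_norm_of_isAdmissible {a : Fin m → Fin n → ℚ}
    (h : IsAdmissible (stdFrame n) (centering a)) (g : torusPoints a) (hg : g ≠ 0) :
    1 < ∑ j, ‖(g : Fin n → UnitAddCircle) j‖ := by
  by_contra! hle
  obtain ⟨_, x, hx, rfl⟩ := g
  apply hg
  apply Subtype.ext
  show toTorus n x = 0
  let z : Fin n → ℝ := fun j => (round (x j) : ℝ)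
  have hz : z ∈ Submodule.span ℤ (Set.range (stdFrame n)) :=
    (mem_span_stdFrame _).2 ⟨fun j => round (x j), fun j => rfl⟩
  have hmem : x - z ∈ octahedron (stdFrame n) ∩ (centering a : Set (Fin n → ℝ)) := by
    refine ⟨⟨x - z, (sum_smul_stdFrame _).symm, ?_⟩,
      Submodule.sub_mem _ hx (span_stdFrame_le_centering a hz)⟩
    refine le_trans (le_of_eq (Finset.sum_congr rfl fun j _ => ?_)) hle
    exact (UnitAddCircle.norm_eq).symm
  have hs : x - z ∈ Submodule.span ℤ (Set.range (stdFrame n)) := by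
    rw [h] at hmem
    rcases hmem with (h0 | ⟨i, hi⟩) | ⟨i, hi⟩
    · rw [Set.mem_singleton_iff.1 h0]; exact Submodule.zero_mem _
    · rw [← hi]; exact Submodule.subset_span ⟨i, rfl⟩
    · rw [← hi]; exact Submodule.neg_mem _ (Submodule.subset_span ⟨i, rfl⟩)
  rw [toTorus_eq_zero_iff]
  simpa using Submodule.add_mem _ hs hz

/-- The generator of `Λ / ℤⁿ` given by the vector `a k`. -/
noncomputable def torusGenerator (a : Fin m → Fin n → ℚ) (k : Fin m) : torusPoints a :=
  ⟨toTorus n fun j => ((a k j : ℚ) : ℝ), _, Submodule.subset_span (Or.inr ⟨k, rfl⟩), rfl⟩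

theorem exists_eq_sum_torusGenerator (a : Fin m → Fin n → ℚ) (g : torusPoints a) :
    ∃ k : Fin m → ℤ, g = ∑ i, k i • torusGenerator a i := by
  obtain ⟨_, x, hx, rfl⟩ := g
  have hx' : x ∈ centering a := hx
  rw [centering, Submodule.span_union, Submodule.mem_sup] at hx'
  obtain ⟨u, hu, v, hv, rfl⟩ := hx'
  obtain ⟨k, rfl⟩ := (Submodule.mem_span_range_iff_exists_fun ℤ).1 hv
  refine ⟨k, Subtype.ext ?_⟩
  show toTorus n _ = _
  rw [map_add, (toTorus_eq_zero_iff u).2 hu, zero_add, map_sum, AddSubgroup.val_finsetSum]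
  refine Finset.sum_congr rfl fun i _ => ?_
  rw [map_zsmul]
  rfl

/-- If the coordinates in `T` detect the non-integral points of `Λ`, then the remaining vectors of
the standard frame extend to a basis of `Λ`. -/
theorem frameDefect_le_card (a : Fin m → Fin n → ℚ) (T : Finset (Fin n))
    (hT : ∀ x ∈ centering a, (∀ j ∈ T, ∃ z : ℤ, x j = z) →
      x ∈ Submodule.span ℤ (Set.range (stdFrame n))) :
    frameDefect (stdFrame n) (centering a) ≤ T.card := by
  classical
  obtain ⟨b₀⟩ := nonempty_basis_centering a
  have : Module.Finite ℤ (centering a) := Module.Finite.of_basis b₀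
  have : Module.Free ℤ (centering a) := Module.Free.of_basis b₀
  let e : {i // i ∉ T} → centering a := fun i =>
    ⟨stdFrame n i, span_stdFrame_le_centering a (Submodule.subset_span ⟨i, rfl⟩)⟩
  have he : LinearIndependent ℤ e := by
    refine LinearIndependent.of_comp (centering a).subtype ?_
    exact (stdFrame_linearIndependent n).comp _ Subtype.val_injective
  let W : Submodule ℤ (centering a) := Submodule.span ℤ (Set.range e)
  let bW : Module.Basis {i // i ∉ T} ℤ W := Module.Basis.span he
  -- With `hW0` this identifies `W` with the points of `Λ` whose coordinates in `T` vanish.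
  have hW : ∀ x : centering a, (∀ j ∈ T, (x : Fin n → ℝ) j = 0) → x ∈ W := by
    intro x hx
    obtain ⟨c, hc⟩ := (mem_span_stdFrame _).1
      (hT x x.2 fun j hj => ⟨0, by rw [hx j hj, Int.cast_zero]⟩)
    refine (Submodule.mem_span_range_iff_exists_fun ℤ).2 ⟨fun i => c i, Subtype.ext ?_⟩
    funext j
    have h1 : ((∑ i : {i // i ∉ T}, c i • e i : centering a) : Fin n → ℝ) j =
        ∑ i : {i // i ∉ T}, (c i : ℝ) * stdFrame n i j := by
      simp [e]
    rw [h1]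
    by_cases hj : j ∈ T
    · rw [hx j hj]
      refine Finset.sum_eq_zero fun i _ => ?_
      have : j ≠ i := fun h => i.2 (h ▸ hj)
      simp [stdFrame, this]
    · rw [Finset.sum_eq_single ⟨j, hj⟩, hc j]
      · simp [stdFrame]
      · intro i _ hi
        have : j ≠ i := fun h => hi (Subtype.ext h.symm)
        simp [stdFrame, this]
      · simp
  have hW0 : ∀ x ∈ W, ∀ j ∈ T, (x : Fin n → ℝ) j = 0 := by
    intro x hx j hj
    have hle : W ≤ LinearMap.ker ((LinearMap.proj (R := ℤ) (φ := fun _ : Fin n => ℝ) j).comp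
        (centering a).subtype) := by
      refine Submodule.span_le.2 ?_
      rintro _ ⟨i, rfl⟩
      have : j ≠ i := fun h => i.2 (h ▸ hj)
      simp [e, stdFrame, this]
    exact hle hx
  -- Vanishing of a coordinate is unaffected by a nonzero integer factor, so `W` is saturated. The
  -- quotient is then free, and its basis completes that of `W`; counting ranks, it has `|T|`
  -- elements.
  have : Module.IsTorsionFree ℤ (centering a ⧸ W) := by
    refine Module.IsTorsionFree.of_smul_eq_zero fun r q hq => ?_
    obtain ⟨x, rfl⟩ := Submodule.Quotient.mk_surjective W q
    rw [← Submodule.Quotient.mk_smul, Submodule.Quotient.mk_eq_zero] at hq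
    refine or_iff_not_imp_left.2 fun hr => (Submodule.Quotient.mk_eq_zero W).2 (hW x fun j hj => ?_)
    have h1 := hW0 _ hq j hj
    have h2 : (r : ℝ) * (x : Fin n → ℝ) j = 0 := by simpa using h1
    exact (mul_eq_zero.1 h2).resolve_left (by exact_mod_cast hr)
  let bQ := Module.Free.chooseBasis ℤ (centering a ⧸ W)
  let b := bW.sumQuot bQ
  have hcard : Fintype.card {i // i ∉ T} +
      Fintype.card (Module.Free.ChooseBasisIndex ℤ (centering a ⧸ W)) = n := by
    rw [← Fintype.card_sum, ← Module.finrank_eq_card_basis b, Module.finrank_eq_card_basis b₀,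
      Fintype.card_fin]
  have hcT : Fintype.card {i // i ∉ T} + Fintype.card {i // ¬ i ∉ T} = n := by
    rw [← Fintype.card_sum, Fintype.card_congr (Equiv.sumCompl fun i => i ∉ T), Fintype.card_fin]
  obtain ⟨f⟩ : Nonempty (Module.Free.ChooseBasisIndex ℤ (centering a ⧸ W) ≃ {i // ¬ i ∉ T}) :=
    Fintype.card_eq.1 (by omega)
  let E := (Equiv.sumCongr (Equiv.refl _) f).trans (Equiv.sumCompl fun i => i ∉ T)
  refine Nat.sInf_le ⟨Tᶜ, ?_, b.reindex E, fun i hi => ?_⟩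
  · simp
  · have hi' : i ∉ T := by simpa using hi
    have hE : E.symm i = Sum.inl ⟨i, hi'⟩ := by
      rw [Equiv.symm_apply_eq]
      simp [E]
    rw [Module.Basis.reindex_apply, hE, Module.Basis.sumQuot_inl, Module.Basis.span_apply]

/-- A bound for the defect of an admissible octahedron with free parameters `y`, `D` and `k`. -/
theorem frameDefect_le_of_isAdmissible [NeZero n] {a : Fin m → Fin n → ℚ}
    (h : IsAdmissible (stdFrame n) (centering a)) {y D : ℝ} (hy : 1 < y) (hD : 1 ≤ D)
    (hmD : Real.log (m * Real.log y) ≤ D) (k : ℕ) :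
    (frameDefect (stdFrame n) (centering a) : ℝ) ≤ k + n * Real.log n / Real.log y *
      Real.exp (-(k * (Real.log y / D / n))) + m * y := by
  let χ : Fin n → torusPoints a →+ UnitAddCircle := fun j =>
    (Pi.evalAddMonoidHom _ j).comp (torusPoints a).subtype
  have hχ : ∀ g : torusPoints a, g ≠ 0 → 1 < ∑ j, ‖χ j g‖ := one_lt_sum_norm_of_isAdmissible h
  have : Finite (torusPoints a) :=
    (finite_and_card_le_of_one_lt_sum_norm Finset.univ χ hχ).1
  obtain ⟨T, hT, hcard⟩ := exists_separating_card_le χ hχ (torusGenerator a)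
    (exists_eq_sum_torusGenerator a) hy hD hmD k
  rw [Fintype.card_fin] at hcard
  refine le_trans (Nat.cast_le.2 (frameDefect_le_card a T fun x hx hxT => ?_)) hcard
  have := hT ⟨toTorus n x, x, hx, rfl⟩ fun j hj => (toTorus_apply_eq_zero_iff x j).2 (hxT j hj)
  exact (toTorus_eq_zero_iff x).1 (congrArg Subtype.val this)

end Lattice

/-! ### Choice of parameters and the final estimate -/

theorem maxDefect_le (n m : ℕ) : maxDefect n m ≤ n := by
  obtain ⟨_, ⟨a, rfl⟩, -, h⟩ := (maxDefect_isGreatest n m).1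
  obtain ⟨S, hS, -⟩ := frameDefect_mem (stdFrame n) a
  omega

/-- The bound for the defect when `n` is much larger than `m`. -/
theorem maxDefect_le_of_log_le {n m : ℕ} (hm : 1 ≤ m) (hmn : m + 1 < n)
    (hL : 3 ≤ Real.log ((n : ℝ) / m)) (hmL : Real.log m ≤ Real.log ((n : ℝ) / m)) :
    (maxDefect n m : ℝ) ≤
      13 * (n / Real.log ((n : ℝ) / m) * (Real.log (m * Real.log ((n : ℝ) / m))) ^ 2) := by
  have hm0 : (0 : ℝ) < m := by exact_mod_cast hm
  have hm1 : (1 : ℝ) ≤ m := by exact_mod_cast hm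
  have hn0 : (0 : ℝ) < n := by exact_mod_cast (by omega : 0 < n)
  have : NeZero n := ⟨by omega⟩
  obtain ⟨_, ⟨a, rfl⟩, hadm, h⟩ := (maxDefect_isGreatest n m).1
  rw [h]
  have hnL : Real.log n = Real.log ((n : ℝ) / m) + Real.log m := by
    rw [Real.log_div hn0.ne' hm0.ne']; ring
  have hexp : Real.exp (Real.log ((n : ℝ) / m)) = n / m := Real.exp_log (by positivity)
  generalize Real.log ((n : ℝ) / m) = L at *
  have hL0 : 0 < L := by linarith
  set M := Real.log (m * L) with hM
  have hLM : Real.log L ≤ M := Real.log_le_log hL0 (by nlinarith)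
  have hM1 : 1 ≤ M := by
    have : Real.exp 1 ≤ 3 := by linarith [Real.exp_one_lt_d9]
    calc (1 : ℝ) = Real.log (Real.exp 1) := (Real.log_exp 1).symm
      _ ≤ Real.log L := Real.log_le_log (Real.exp_pos 1) (this.trans hL)
      _ ≤ M := hLM
  have hM0 : 0 < M := by linarith
  -- Here `y = √(n/m)`, so `log y = L / 2` and `σ = L / (2M)`. The value of `k` makes `k σ / n ≥ M ≥
  -- log L`, so the exponential is at most `1 / L`.
  have hbound := frameDefect_le_of_isAdmissible hadm (y := Real.exp (L / 2)) (D := M)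
    (Real.one_lt_exp_iff.2 (by linarith)) hM1 (by
      rw [Real.log_exp]
      exact Real.log_le_log (by positivity) (by nlinarith))
    ⌈n / L * (2 * M) * M⌉₊
  rw [Real.log_exp] at hbound
  have hk := Nat.le_ceil (n / L * (2 * M) * M)
  have hk' := (Nat.ceil_lt_add_one (a := n / L * (2 * M) * M) (by positivity)).le
  generalize (⌈n / L * (2 * M) * M⌉₊ : ℝ) = k at *
  have hE : Real.exp (-(k * (L / 2 / M / n))) ≤ 1 / L := by
    have h1 : M ≤ k * (L / 2 / M / n) := by
      calc M = n / L * (2 * M) * M * (L / 2 / M / n) := by field_simp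
        _ ≤ _ := mul_le_mul_of_nonneg_right hk (by positivity)
    calc Real.exp (-(k * (L / 2 / M / n))) ≤ Real.exp (-Real.log L) :=
          Real.exp_le_exp.2 (by linarith)
      _ = 1 / L := by rw [Real.exp_neg, Real.exp_log hL0, one_div]
  -- This is `m y = n / y` together with `y ≥ log y = L / 2`.
  have hsmall : m * Real.exp (L / 2) ≤ 2 * (n / L) := by
    have h1 : (m : ℝ) * (Real.exp (L / 2) * Real.exp (L / 2)) = n := by
      rw [← Real.exp_add, add_halves, hexp]; field_simp
    have h2 : L / 2 ≤ Real.exp (L / 2) := by linarith [Real.add_one_le_exp (L / 2)]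
    rw [← mul_div_assoc, le_div_iff₀ hL0]
    have h3 : m * Real.exp (L / 2) * (L / 2) ≤ m * Real.exp (L / 2) * Real.exp (L / 2) :=
      mul_le_mul_of_nonneg_left h2 (by positivity)
    nlinarith
  have hbig : n * Real.log n / (L / 2) * Real.exp (-(k * (L / 2 / M / n))) ≤ 4 * (n / L) := by
    -- The assumption `log m ≤ L` enters here: it gives `log n = L + log m ≤ 2 L`.
    have h1 : n * Real.log n / (L / 2) ≤ 4 * n := by
      rw [div_le_iff₀ (by positivity), hnL]
      nlinarith
    calc _ ≤ 4 * n * (1 / L) :=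
          mul_le_mul h1 hE (Real.exp_pos _).le (by positivity)
      _ = 4 * (n / L) := by ring
  have hone : 1 ≤ n / L := by
    rw [le_div_iff₀ hL0, one_mul]
    have h1 := Real.add_one_le_exp L
    rw [hexp] at h1
    have h2 : (n : ℝ) / m ≤ n := div_le_self hn0.le hm1
    linarith
  have hM2 : 1 ≤ M ^ 2 := one_le_pow₀ hM1
  have hq : n / L ≤ n / L * M ^ 2 := le_mul_of_one_le_right (by positivity) hM2
  have hk2 : n / L * (2 * M) * M = 2 * (n / L * M ^ 2) := by ring
  linarith

/-- Bernoulli's inequality for `(1 + 2/m) ^ m`. It keeps the iterated logarithm above the positive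
constant `log (log 3)`, so its square can be absorbed in the constant. -/
theorem three_le_div_pow {m n : ℕ} (hm : 1 ≤ m) (hmn : m + 1 < n) :
    (3 : ℝ) ≤ ((n : ℝ) / m) ^ m := by
  have hm0 : (0 : ℝ) < m := by exact_mod_cast hm
  have hn : (m : ℝ) + 2 ≤ n := by exact_mod_cast hmn
  have h1 := one_add_mul_le_pow (a := (2 : ℝ) / m) (by have : 0 < (2 : ℝ) / m := by positivity
                                                       linarith) m
  have h2 : 1 + (m : ℝ) * (2 / m) = 3 := by field_simp; norm_num
  rw [h2] at h1
  refine h1.trans (pow_le_pow_left₀ (by positivity) ?_ m)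
  rw [le_div_iff₀ hm0]
  have : (1 + 2 / (m : ℝ)) * m = m + 2 := by field_simp
  linarith

theorem theorem1 :
    ∃ C : ℝ, 0 < C ∧ ∀ m n : ℕ, 1 ≤ m → m + 1 < n →
      (maxDefect n m : ℝ) ≤
        C * ((n : ℝ) * Real.log ((m : ℝ) + 1) / Real.log ((n : ℝ) / (m : ℝ))) *
          (Real.log (Real.log (((n : ℝ) / (m : ℝ)) ^ m))) ^ 2 := by
  have hlog3 : 1 < Real.log 3 := by
    rw [Real.lt_log_iff_exp_lt (by norm_num)]
    linarith [Real.exp_one_lt_d9]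
  have hc : 0 < Real.log (Real.log 3) := Real.log_pos hlog3
  have hlog2 : 0 < Real.log 2 := Real.log_pos one_lt_two
  set c := Real.log (Real.log 3) with hcdef
  -- One summand per case: the main estimate, then `L < 3`, then `log m > L`. In the last two the
  -- defect is bounded by `n`.
  refine ⟨13 / Real.log 2 + 3 / (Real.log 2 * c ^ 2) + 1 / c ^ 2, by positivity,
    fun m n hm hmn => ?_⟩
  have hm0 : (0 : ℝ) < m := by exact_mod_cast hm
  have hm1 : (1 : ℝ) ≤ m := by exact_mod_cast hm
  have hn0 : (0 : ℝ) < n := by exact_mod_cast (by omega : 0 < n)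
  have hd : (maxDefect n m : ℝ) ≤ n := by exact_mod_cast maxDefect_le n m
  have h3 := three_le_div_pow hm hmn
  have hL0 : 0 < Real.log ((n : ℝ) / m) := by
    refine Real.log_pos ((one_lt_div hm0).2 ?_)
    exact_mod_cast (by omega : m < n)
  have hcM : c ≤ Real.log (Real.log (((n : ℝ) / m) ^ m)) :=
    Real.log_le_log (by linarith) (Real.log_le_log (by norm_num) h3)
  have hmain := maxDefect_le_of_log_le hm hmn
  rw [Real.log_pow] at hcM ⊢
  have hl2 : Real.log 2 ≤ Real.log ((m : ℝ) + 1) := Real.log_le_log two_pos (by linarith)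
  have hlm : Real.log m ≤ Real.log ((m : ℝ) + 1) := Real.log_le_log hm0 (by linarith)
  generalize Real.log ((n : ℝ) / m) = L at *
  generalize Real.log (m * L) = M at *
  generalize Real.log ((m : ℝ) + 1) = l at *
  have hl0 : 0 < l := by linarith
  have hM2 : c ^ 2 ≤ M ^ 2 := pow_le_pow_left₀ hc.le hcM 2
  have hM0 : 0 < M ^ 2 := lt_of_lt_of_le (by positivity) hM2
  have key : ∀ A B C : ℝ, 0 ≤ A → 0 ≤ B → 0 ≤ C → ∀ x : ℝ, 0 ≤ x →
      A * x ≤ (A + B + C) * x ∧ B * x ≤ (A + B + C) * x ∧ C * x ≤ (A + B + C) * x := by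
    intro A B C hA hB hC x hx
    exact ⟨mul_le_mul_of_nonneg_right (by linarith) hx,
      mul_le_mul_of_nonneg_right (by linarith) hx, mul_le_mul_of_nonneg_right (by linarith) hx⟩
  obtain ⟨k1, k2, k3⟩ := key (13 / Real.log 2) (3 / (Real.log 2 * c ^ 2)) (1 / c ^ 2)
    (by positivity) (by positivity) (by positivity) (n * l / L * M ^ 2) (by positivity)
  rw [mul_assoc]
  by_cases hL3 : 3 ≤ L
  · by_cases hmL : Real.log m ≤ L
    · refine (hmain hL3 hmL).trans (le_trans ?_ k1)
      have : 13 / Real.log 2 * (n * l / L * M ^ 2) =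
          13 * (n / L * M ^ 2) * (l / Real.log 2) := by ring
      rw [this]
      exact le_mul_of_one_le_right (by positivity) ((one_le_div hlog2).2 hl2)
    -- Here `log (m + 1) ≥ log m > L`, so the claimed bound already exceeds `n`; only this case uses
    -- the factor `log (m + 1)` beyond its lower bound `log 2`.
    · refine hd.trans (le_trans ?_ k3)
      have : 1 / c ^ 2 * (n * l / L * M ^ 2) = n * ((l / L) * (M ^ 2 / c ^ 2)) := by ring
      rw [this]
      refine le_mul_of_one_le_right hn0.le (one_le_mul_of_one_le_of_one_le ?_ ?_)
      · exact (one_le_div hL0).2 (by linarith)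
      · exact (one_le_div (by positivity)).2 hM2
  · refine hd.trans (le_trans ?_ k2)
    have : 3 / (Real.log 2 * c ^ 2) * (n * l / L * M ^ 2) =
        n * ((3 / L) * (l / Real.log 2) * (M ^ 2 / c ^ 2)) := by field_simp
    rw [this]
    refine le_mul_of_one_le_right hn0.le (one_le_mul_of_one_le_of_one_le
      (one_le_mul_of_one_le_of_one_le ?_ ?_) ?_)
    · exact (one_le_div hL0).2 (by linarith)
    · exact (one_le_div hlog2).2 hl2
    · exact (one_le_div (by positivity)).2 hM2
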